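/- **Theorem (quantum number distribution tail bound).** There is an absolute constant $C>0$ with the following property. Let $\mathcal H$ be a complex Hilbert space that is the orthogonal direct sum $\mathcal H=\bigoplus_{\lambda\in\mathbb Z}\mathcal V_\lambda$ of closed subspaces, let $\Pi_\lambda$ be the orthogonal projection onto $\mathcal V_\lambda$, and for real $\Lambda\ge 0$ put $\Pi_{[-\Lambda,\Lambda]}=\sum_{|\lambda|\le\Lambda}\Pi_\lambda$ and $\overline\Pi_{[-\Lambda,\Lambda]}=I-\Pi_{[-\Lambda,\Lambda]}$. Let $\chi>0$ and $0\le r<1$, and let $H$ be a (possibly unbounded) self-adjoint operator on $\mathcal H$ of the form $H=H_W+H_R$, with $H_W$ symmetric and $H_R$ self-adjoint (that is, $H$ agrees with $H_W+H_R$ on $\mathrm{dom}(H_W)\cap\mathrm{dom}(H_R)\subseteq\mathrm{dom}(H)$), such that 1. $\Pi_\lambda H_W\Pi_{\lambda'}=0$ whenever $|\lambda-\lambda'|>1$; 2. for every integer $\Lambda\ge 0$, $H_W\Pi_{[-\Lambda,\Lambda]}$ is defined on all of $\mathcal H$ and $\|H_W\Pi_{[-\Lambda,\Lambda]}\|\le\chi(\Lambda+1)^r$;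 3. $[H_R,\Pi_\lambda]=0$ for all $\lambda$ (that is, $\Pi_\lambda$ maps $\mathrm{dom}(H_R)$ into itself and commutes with $H_R$ there). Let $|\Psi\rangle$ be a normalized eigenstate of $H$ whose eigenvalue $\varepsilon$ has multiplicity $1$ and is separated from the rest of the spectrum of $H$ by a gap $\delta>0$ (every other point $z$ of the spectrum satisfies $|z-\varepsilon|\ge\delta$), and suppose that $$\sum_{\lambda\in\mathbb Z}|\lambda|\,\langle\Psi|\Pi_\lambda|\Psi\rangle=\bar\lambda<\infty .$$ Then for every $\epsilon>0$ there is a real $\Lambda\ge 0$ with $$\Big|\Lambda^{1-r}-(2\bar\lambda)^{1-r}\Big|\le C\left(\chi\delta^{-1}\log^2(\epsilon^{-1})+|\log(\epsilon^{-1})|\right) \qquad\text{and}\qquad \big\|\overline\Pi_{[-\Lambda,\Lambda]}|\Psi\rangle\big\|\le\epsilon .$$ In other words, $\|\overline\Pi_{[-\Lambda,\Lambda]}|\Psi\rangle\|\le\epsilon$ for some $\Lambda$ with $\Lambda^{1-r}=(2\bar\lambda)^{1-r}+\mathcal O\big(\chi\delta^{-1}\log^2(\epsilon^{-1})+\log(\epsilon^{-1})\big)$.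 -/

import Mathlib

open scoped InnerProductSpace

namespace QuantumNumberTail

variable {E : Type*} [NormedAddCommGroup E] [InnerProductSpace ℂ E]

/-- The resolvent set of a (possibly unbounded) operator `H`: those `z` for which
`H - z : dom H → E` is a bijection with an everywhere defined bounded inverse `R`. -/
def resolventSet (H : E →ₗ.[ℂ] E) : Set ℂ :=
  {z | ∃ R : E →L[ℂ] E,
    (∀ y : E, ∃ hy : R y ∈ H.domain, H ⟨R y, hy⟩ - z • R y = y) ∧
    ∀ x : H.domain, R (H x - z • (x : E)) = x}

/-- The spectrum of a (possibly unbounded) operator. -/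
def spectrum (H : E →ₗ.[ℂ] E) : Set ℂ := (resolventSet H)ᶜ

/-- The eigenspace `{x ∈ dom H | H x = z x}` of a (possibly unbounded) operator. -/
def eigenspace (H : E →ₗ.[ℂ] E) (z : ℂ) : Submodule ℂ E :=
  (LinearMap.ker (H.toFun - z • H.domain.subtype)).map H.domain.subtype

/-- The projection `Π_[-Λ,Λ] = ∑_{|l| ≤ Λ} Π_l`, where `Π_l` is the orthogonal projection
onto the subspace `V l` of quantum number `l ∈ ℤ`, and the threshold `Λ` is real. -/
noncomputable def window (V : ℤ → Submodule ℂ E) [∀ l, (V l).HasOrthogonalProjection]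
    (Λ : ℝ) : E →L[ℂ] E :=
  ∑ l ∈ Finset.Icc ⌈-Λ⌉ ⌊Λ⌋, (V l).starProjection

/-- `H = H_W + H_R` is a Hamiltonian of the framework, with parameters `χ` and `r`, for the
quantum number whose eigenspaces are the `V l`. All operators may be unbounded. As usual for
unbounded operators, `H = H_W + H_R` means that the self-adjoint operator `H` is a realization of
the sum: it agrees with `H_W + H_R` on `dom H_W ∩ dom H_R`. -/
structure IsFrameworkHamiltonian [CompleteSpace E] (V : ℤ → Submodule ℂ E)
    [∀ l, (V l).HasOrthogonalProjection] (H HW HR : E →ₗ.[ℂ] E) (χ r : ℝ) : Prop where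
  /-- The Hilbert space is the orthogonal direct sum of the `V l`. -/
  hilbertSum : IsHilbertSum ℂ (fun l => V l) fun l => (V l).subtypeₗᵢ
  selfAdjoint : IsSelfAdjoint H
  selfAdjoint_R : IsSelfAdjoint HR
  symmetric_W : HW.IsFormalAdjoint HW
  sum_le : HW + HR ≤ H
  chi_pos : 0 < χ
  r_nonneg : 0 ≤ r
  r_lt_one : r < 1
  /-- `Π_l H_W Π_l' = 0` if `|l - l'| > 1`. -/
  hop : ∀ l l' : ℤ, 1 < |l - l'| → ∀ (x : E) (hx : (V l').starProjection x ∈ HW.domain),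
    (V l).starProjection (HW ⟨(V l').starProjection x, hx⟩) = 0
  /-- `H_W Π_[-Λ,Λ]` is everywhere defined, with operator norm at most `χ (Λ + 1) ^ r`. -/
  norm_le : ∀ (Λ : ℕ) (x : E), ∃ hx : window V Λ x ∈ HW.domain,
    ‖HW ⟨window V Λ x, hx⟩‖ ≤ χ * ((Λ : ℝ) + 1) ^ r * ‖x‖
  /-- `[H_R, Π_l] = 0`: the projection `Π_l` preserves `dom H_R` and commutes with `H_R` there. -/
  commute : ∀ (l : ℤ) (x : HR.domain), ∃ hx : (V l).starProjection (x : E) ∈ HR.domain,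
    HR ⟨(V l).starProjection (x : E), hx⟩ = (V l).starProjection (HR x)

end QuantumNumberTail

/-! This is an Agmon-type estimate. Let `F = ∑ f l • Π_l` with `f ≥ 0` finitely supported. Since
`H_R` commutes with each `Π_l`, `(H - e) F Ψ = [H, F] Ψ = [H_W, F] Ψ`. As `H_W` moves the quantum
number by at most one, this commutator sees only differences of neighbouring values of `f`
(`IsHopping.norm_commutator_sq_le`). If `f` varies slowly against the hopping strength `χ (|l| + 1)
^ r`, then `‖(H - e) F Ψ‖` is a small multiple of `δ (‖F Ψ‖ + 1)`, so the spectral gap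
(`gap_mul_norm_sub_le`) makes `F Ψ` nearly parallel to `Ψ`.

By Markov's inequality at least half of the mass of `Ψ` lies in `|l| ≤ 2 * lbar`. If `f ≤ 1` there,
the overlap of `F Ψ` with `Ψ` is at most `1 + (3/4) ‖F Ψ‖`, whence `‖F Ψ‖ ≤ 8` (`norm_diagonal_le`).

In the variable `|l| ^ (1 - r)` the hopping strength is uniform, so `f` may grow like `exp (a |l| ^
(1 - r))` with `a` of order `min 1 (δ / χ)` (`exists_weight`). The tail is then at most `8 exp (-a
T)` at distance `T` in this variable. Taking `a T = log (8 / ε)` gives a shift of order `(1 + χ / δ)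
log (1 / ε)`, which is stronger than the claim. -/

namespace QuantumNumberTail

/-! ### Spectral gap of an unbounded operator, through its resolvent -/

section SpectralGap

variable {E : Type*} [NormedAddCommGroup E] [InnerProductSpace ℂ E]

/-- `R` is the resolvent `(H - z)⁻¹`. -/
def IsResolvent (H : E →ₗ.[ℂ] E) (z : ℂ) (R : E →L[ℂ] E) : Prop :=
  (∀ y : E, ∃ hy : R y ∈ H.domain, H ⟨R y, hy⟩ - z • R y = y) ∧
    ∀ x : H.domain, R (H x - z • (x : E)) = x

theorem IsResolvent.identity {H : E →ₗ.[ℂ] E} {z w : ℂ} {R S : E →L[ℂ] E}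
    (hR : IsResolvent H z R) (hS : IsResolvent H w S) (x : E) :
    S x = R x + (w - z) • R (S x) := by
  obtain ⟨hy, h⟩ := hS.1 x
  have h2 := hR.2 ⟨S x, hy⟩
  have h3 : H ⟨S x, hy⟩ - z • S x = x + (w - z) • S x := by
    rw [sub_eq_iff_eq_add] at h
    rw [h, sub_smul]; abel
  simp only [h3, map_add, map_smul] at h2
  exact h2.symm

/-- Spectral mapping for the resolvent: by the resolvent identity, `μ⁻¹ (1 + μ⁻¹ S)` inverts `μ -
R`. -/
theorem IsResolvent.isUnit_sub {H : E →ₗ.[ℂ] E} {z w μ : ℂ} {R S : E →L[ℂ] E}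
    (hR : IsResolvent H z R) (hS : IsResolvent H w S) (hμ : μ ≠ 0) (hw : w - z = μ⁻¹) :
    IsUnit (algebraMap ℂ (E →L[ℂ] E) μ - R) := by
  have h1 := fun x => hR.identity hS x
  have h2 := fun x => hS.identity hR x
  have hw' : z - w = -μ⁻¹ := by rw [← hw]; ring
  rw [hw] at h1
  rw [hw'] at h2
  have e1 : ∀ x, R (S x) = μ • (S x - R x) := fun x => by
    rw [sub_eq_iff_eq_add'.mpr (h1 x), smul_smul, mul_inv_cancel₀ hμ, one_smul]
  have e2 : ∀ x, S (R x) = μ • (S x - R x) := fun x => by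
    have : S x - R x = μ⁻¹ • S (R x) := by
      have h := h2 x
      rw [neg_smul, ← sub_eq_add_neg, eq_sub_iff_add_eq] at h
      exact sub_eq_iff_eq_add'.mpr h.symm
    rw [this, smul_smul, mul_inv_cancel₀ hμ, one_smul]
  refine ⟨⟨algebraMap ℂ (E →L[ℂ] E) μ - R, μ⁻¹ • (1 + μ⁻¹ • S), ?_, ?_⟩, rfl⟩
  · ext x
    simp [Algebra.algebraMap_eq_smul_one, e1, smul_smul, hμ, smul_sub, smul_add]
  · ext x
    simp [Algebra.algebraMap_eq_smul_one, e2, smul_smul, hμ, smul_sub, smul_add]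

theorem isFormalAdjoint_self [CompleteSpace E] {H : E →ₗ.[ℂ] E} (hH : IsSelfAdjoint H) :
    H.IsFormalAdjoint H := by
  have h := LinearPMap.adjoint_isFormalAdjoint hH.dense_domain
  rwa [LinearPMap.isSelfAdjoint_def.mp hH] at h

theorem IsResolvent.isSelfAdjoint [CompleteSpace E] {H : E →ₗ.[ℂ] E} (hH : IsSelfAdjoint H)
    {z : ℝ} {R : E →L[ℂ] E} (hR : IsResolvent H z R) : IsSelfAdjoint R := by
  rw [ContinuousLinearMap.isSelfAdjoint_iff_isSymmetric]
  intro x y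
  obtain ⟨hx, ex⟩ := hR.1 x
  obtain ⟨hy, ey⟩ := hR.1 y
  have h := isFormalAdjoint_self hH ⟨R x, hx⟩ ⟨R y, hy⟩
  change ⟪R x, y⟫_ℂ = ⟪x, R y⟫_ℂ
  nth_rewrite 1 [← ey]
  nth_rewrite 2 [← ex]
  simp only [inner_sub_left, inner_sub_right, h, inner_smul_left, inner_smul_right,
    Complex.conj_ofReal]

theorem mem_eigenspace_iff {H : E →ₗ.[ℂ] E} {z : ℂ} {x : E} :
    x ∈ eigenspace H z ↔ ∃ hx : x ∈ H.domain, H ⟨x, hx⟩ = z • x := by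
  simp only [eigenspace, Submodule.mem_map, LinearMap.mem_ker]
  constructor
  · rintro ⟨y, hy, rfl⟩
    exact ⟨y.2, sub_eq_zero.mp hy⟩
  · rintro ⟨hx, h⟩
    exact ⟨⟨x, hx⟩, sub_eq_zero.mpr h, rfl⟩

/-- Away from the eigenvalue `e`, the spectrum of the resolvent at `e + τ` is small. -/
theorem IsResolvent.abs_le_of_mem_spectrum [CompleteSpace E] {H : E →ₗ.[ℂ] E} {e δ τ : ℝ}
    (hgap : ∀ z ∈ spectrum H, z ≠ (e : ℂ) → δ ≤ ‖z - (e : ℂ)‖) (hτ : 0 < τ) (hτδ : τ < δ)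
    {R : E →L[ℂ] E} (hR : IsResolvent H ((e + τ : ℝ) : ℂ) R) {μ : ℝ}
    (hμ : μ ∈ _root_.spectrum ℝ R) (hne : μ ≠ -τ⁻¹) : |μ| ≤ (δ - τ)⁻¹ := by
  by_contra! hlt
  have hd : 0 < δ - τ := by linarith
  have hpos : 0 < |μ| := lt_trans (inv_pos.mpr hd) hlt
  have hμ0 : μ ≠ 0 := abs_pos.mp hpos
  have hinv : |μ⁻¹| < δ - τ := by
    rw [abs_inv]; exact inv_lt_of_inv_lt₀ hd hlt
  have hw : ((e + τ + μ⁻¹ : ℝ) : ℂ) ∈ resolventSet H := by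
    by_contra hmem
    have h := hgap _ hmem (by
      intro h
      have h' : e + τ + μ⁻¹ = e := by exact_mod_cast h
      apply hne
      rw [← inv_inv μ, show μ⁻¹ = -τ by linarith, inv_neg])
    rw [← Complex.ofReal_sub, Complex.norm_real, Real.norm_eq_abs] at h
    have h2 : |e + τ + μ⁻¹ - e| ≤ τ + |μ⁻¹| := by
      rw [show e + τ + μ⁻¹ - e = τ + μ⁻¹ by ring]
      exact (abs_add_le _ _).trans (by rw [abs_of_pos hτ])
    linarith
  obtain ⟨S, hS⟩ := hw
  have hu := IsResolvent.isUnit_sub hR hS (μ := (μ : ℂ)) (by exact_mod_cast hμ0)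
    (by push_cast; ring)
  rw [spectrum.mem_iff] at hμ
  apply hμ
  convert hu using 2
  ext x
  simp [Algebra.algebraMap_eq_smul_one]

/-- The bounded self-adjoint `R = (H - e - τ)⁻¹` has its spectrum in `[-B, B]` together with the
point `-τ⁻¹`, which corresponds to `e`. The spectral projection `Q` at that point maps into the line
of `Ψ` and so kills `v`. On the complement `‖R‖ ≤ B = (δ - τ)⁻¹`; then `τ → 0`. -/
theorem gap_mul_norm_le_of_inner_eq_zero [CompleteSpace E] {H : E →ₗ.[ℂ] E}
    (hH : IsSelfAdjoint H) {Ψ : E} {e δ : ℝ}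
    (hsimple : ∀ x ∈ eigenspace H (e : ℂ), ∃ c : ℂ, x = c • Ψ)
    (hgap : ∀ z ∈ spectrum H, z ≠ (e : ℂ) → δ ≤ ‖z - (e : ℂ)‖)
    (v : H.domain) (hv : ⟪Ψ, (v : E)⟫_ℂ = 0) :
    δ * ‖(v : E)‖ ≤ ‖H v - (e : ℂ) • (v : E)‖ := by
  rcases le_or_gt δ 0 with hδ | hδ
  · exact (mul_nonpos_of_nonpos_of_nonneg hδ (norm_nonneg _)).trans (norm_nonneg _)
  have key : ∀ τ : ℝ, 0 < τ → τ < δ / 2 →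
      (δ - τ) * ‖(v : E)‖ ≤ ‖H v - (e : ℂ) • (v : E)‖ + τ * ‖(v : E)‖ := by
    intro τ hτ hτδ
    have hd : 0 < δ - τ := by linarith
    have hz : ((e + τ : ℝ) : ℂ) ∈ resolventSet H := by
      by_contra hmem
      have h := hgap _ hmem (by
        intro h
        have h' : e + τ = e := by exact_mod_cast h
        linarith)
      rw [← Complex.ofReal_sub, Complex.norm_real, Real.norm_eq_abs, add_sub_cancel_left,
        abs_of_pos hτ] at h
      linarith
    obtain ⟨R, hR⟩ := hz
    change IsResolvent H _ R at hR
    have hRsa := hR.isSelfAdjoint hH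
    set B := (δ - τ)⁻¹ with hB
    have hBτ : B < τ⁻¹ := by
      rw [hB]; exact (inv_lt_inv₀ hd hτ).mpr (by linarith)
    have hspec : ∀ μ ∈ _root_.spectrum ℝ R, μ = -τ⁻¹ ∨ |μ| ≤ B := fun μ hμ =>
      or_iff_not_imp_left.mpr (hR.abs_le_of_mem_spectrum hgap hτ (by linarith) hμ)
    -- A continuous function equal to `0` on `[-B, B]` and `1` at `-τ⁻¹`: on the spectrum it is the
    -- indicator of the isolated point.
    let f : ℝ → ℝ := fun x => max 0 (min 1 ((|x| - B) / (τ⁻¹ - B)))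
    have hfc : Continuous f := by fun_prop
    have hf0 : ∀ x, |x| ≤ B → f x = 0 := fun x hx => by
      have : (|x| - B) / (τ⁻¹ - B) ≤ 0 :=
        div_nonpos_of_nonpos_of_nonneg (by linarith) (by linarith)
      simp only [f]
      rw [max_eq_left]
      exact (min_le_right _ _).trans this
    have hf1 : f (-τ⁻¹) = 1 := by
      have : (|-τ⁻¹| - B) / (τ⁻¹ - B) = 1 := by
        rw [abs_neg, abs_of_pos (inv_pos.mpr hτ), div_self (by linarith)]
      simp only [f]; rw [this]; simp
    set Q := cfc f R with hQ
    have hQsa : IsSelfAdjoint Q := cfc_predicate f R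
    have hmul : cfc (fun x : ℝ => x * f x) R = R * Q := by
      rw [cfc_mul (fun x : ℝ => x) f R (by fun_prop) (by fun_prop), cfc_id' ℝ R]
    have hRQ : R * Q = (-τ⁻¹ : ℝ) • Q := by
      have h2 : cfc (fun x : ℝ => (-τ⁻¹) • f x) R = (-τ⁻¹ : ℝ) • Q :=
        cfc_smul (-τ⁻¹) f R (by fun_prop)
      rw [← hmul, ← h2]
      apply cfc_congr
      intro x hx
      rcases hspec x hx with h | h
      · subst h; simp
      · simp [hf0 x h]
    have hQmem : ∀ x, Q x ∈ eigenspace H (e : ℂ) := by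
      intro x
      have h1 : R (Q x) = (-τ⁻¹ : ℝ) • Q x := by
        have := congrArg (fun T : E →L[ℂ] E => T x) hRQ
        simpa using this
      have h2 : Q x = (-τ : ℂ) • R (Q x) := by
        rw [h1, ← Complex.coe_smul, smul_smul]
        have : (τ : ℂ) ≠ 0 := by exact_mod_cast hτ.ne'
        push_cast
        rw [neg_mul_neg, mul_inv_cancel₀ this, one_smul]
      obtain ⟨hy, h3⟩ := hR.1 (Q x)
      rw [mem_eigenspace_iff]
      have hm : Q x ∈ H.domain := by rw [h2]; exact H.domain.smul_mem _ hy
      refine ⟨hm, ?_⟩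
      have h4 : (⟨Q x, hm⟩ : H.domain) = (-τ : ℂ) • ⟨R (Q x), hy⟩ := Subtype.ext h2
      rw [h4, LinearPMap.map_smul, eq_add_of_sub_eq h3, smul_add, smul_comm, ← h2]
      push_cast
      rw [add_smul]
      simp
    -- `Q v` is a multiple of `Ψ`, while `⟪Ψ, Q v⟫ = ⟪Q Ψ, v⟫` is a multiple of `⟪Ψ, v⟫ = 0`.
    have hQv : Q v = 0 := by
      obtain ⟨c, hc⟩ := hsimple _ (hQmem v)
      obtain ⟨d, hd⟩ := hsimple _ (hQmem Ψ)
      have h1 : ⟪Q v, Q v⟫_ℂ = 0 := by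
        nth_rewrite 1 [hc]
        have hs : ⟪Q Ψ, (v : E)⟫_ℂ = ⟪Ψ, Q v⟫_ℂ :=
          (ContinuousLinearMap.isSelfAdjoint_iff_isSymmetric.mp hQsa) Ψ v
        rw [inner_smul_left, ← hs, hd, inner_smul_left, hv]
        simp
      exact inner_self_eq_zero.mp h1
    have hbound : ‖R - R * Q‖ ≤ B := by
      have h2 : cfc (fun x : ℝ => x - x * f x) R = R - R * Q := by
        rw [cfc_sub (fun x : ℝ => x) (fun x => x * f x) R (by fun_prop) (by fun_prop), hmul,
          cfc_id' ℝ R]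
      rw [← h2]
      apply norm_cfc_le (inv_pos.mpr hd).le
      intro x hx
      rcases hspec x hx with h | h
      · subst h; simp [hf1, hd.le]
      · simpa [hf0 x h] using h
    set y := H v - ((e + τ : ℝ) : ℂ) • (v : E) with hy
    have hRy : R y = v := hR.2 v
    have hQy : R (Q y) = 0 := by
      have hcomm : R * Q = Q * R := by
        have := cfc_commute_cfc (fun x : ℝ => x) f R
        rw [cfc_id' ℝ R] at this
        exact this
      have := congrArg (fun T : E →L[ℂ] E => T y) hcomm
      simp only [mul_apply_eq_comp, hRy, hQv] at this
      exact this
    have hvy : ‖(v : E)‖ ≤ B * ‖y‖ := by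
      have h := (R - R * Q).le_of_opNorm_le hbound y
      simpa [hRy, hQy] using h
    have hy2 : ‖y‖ ≤ ‖H v - (e : ℂ) • (v : E)‖ + τ * ‖(v : E)‖ := by
      have : y = (H v - (e : ℂ) • (v : E)) - (τ : ℂ) • (v : E) := by
        rw [hy]; push_cast; rw [add_smul]; abel
      rw [this]
      refine (norm_sub_le _ _).trans ?_
      rw [norm_smul, Complex.norm_real, Real.norm_eq_abs, abs_of_pos hτ]
    have : (δ - τ) * ‖(v : E)‖ ≤ ‖y‖ := by
      rwa [hB, ← div_eq_inv_mul, le_div_iff₀' hd] at hvy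
    linarith
  by_contra! hlt
  set a := ‖H v - (e : ℂ) • (v : E)‖
  have hv0 : 0 < ‖(v : E)‖ := by
    by_contra! h
    have : ‖(v : E)‖ = 0 := le_antisymm h (norm_nonneg _)
    rw [this, mul_zero] at hlt
    exact absurd hlt (not_lt.mpr (norm_nonneg _))
  -- With `τ ≤ g`, the loss `2 τ ‖v‖` in `key` is at most half of the supposed deficit `δ ‖v‖ - a`.
  set g := (δ * ‖(v : E)‖ - a) / (4 * ‖(v : E)‖) with hg
  have hgpos : 0 < g := div_pos (by linarith) (by linarith)
  have h := key (min g (δ / 4)) (lt_min hgpos (by linarith))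
    (lt_of_le_of_lt (min_le_right _ _) (by linarith))
  have h1 : min g (δ / 4) * ‖(v : E)‖ ≤ g * ‖(v : E)‖ :=
    mul_le_mul_of_nonneg_right (min_le_left _ _) hv0.le
  have h2 : g * ‖(v : E)‖ = (δ * ‖(v : E)‖ - a) / 4 := by
    rw [hg]; field_simp
  nlinarith

/-- A simple eigenvalue at distance `δ` from the rest of the spectrum: `H - e` is bounded below by
`δ` on the component orthogonal to the eigenvector. -/
theorem gap_mul_norm_sub_le [CompleteSpace E] {H : E →ₗ.[ℂ] E} (hH : IsSelfAdjoint H) {Ψ : E}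
    {e δ : ℝ} (hΨ1 : ‖Ψ‖ = 1) (hΨ : Ψ ∈ eigenspace H (e : ℂ))
    (hdim : Module.finrank ℂ (eigenspace H (e : ℂ)) = 1)
    (hgap : ∀ z ∈ spectrum H, z ≠ (e : ℂ) → δ ≤ ‖z - (e : ℂ)‖) (u : H.domain) :
    δ * ‖(u : E) - ⟪Ψ, (u : E)⟫_ℂ • Ψ‖ ≤ ‖H u - (e : ℂ) • (u : E)‖ := by
  have hsimple : ∀ x ∈ eigenspace H (e : ℂ), ∃ c : ℂ, x = c • Ψ := by
    intro x hx
    have hne : (⟨Ψ, hΨ⟩ : eigenspace H (e : ℂ)) ≠ 0 := by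
      intro h
      have : Ψ = 0 := congrArg Subtype.val h
      simp [this] at hΨ1
    obtain ⟨c, hc⟩ := (finrank_eq_one_iff_of_nonzero' _ hne).mp hdim ⟨x, hx⟩
    exact ⟨c, (congrArg Subtype.val hc).symm⟩
  obtain ⟨hd, he⟩ := mem_eigenspace_iff.mp hΨ
  have hcoe : ((u - ⟪Ψ, (u : E)⟫_ℂ • ⟨Ψ, hd⟩ : H.domain) : E) = u - ⟪Ψ, (u : E)⟫_ℂ • Ψ := rfl
  have h := gap_mul_norm_le_of_inner_eq_zero hH hsimple hgap
    (u - ⟪Ψ, (u : E)⟫_ℂ • ⟨Ψ, hd⟩) (by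
      rw [hcoe]
      simp [inner_self_eq_norm_sq_to_K, hΨ1])
  rw [hcoe, LinearPMap.map_sub, LinearPMap.map_smul, he] at h
  convert h using 2
  rw [smul_sub]
  rw [smul_comm (⟪Ψ, (u : E)⟫_ℂ) (e : ℂ)]
  abel

end SpectralGap

/-! ### Components in the orthogonal direct sum -/

section HilbertSum

variable {E : Type*} [NormedAddCommGroup E] [InnerProductSpace ℂ E]
  {V : ℤ → Submodule ℂ E} [∀ l, (V l).HasOrthogonalProjection]

/-- The operator `∑ l ∈ S, f l • Π_l`. -/
noncomputable def diagonal (V : ℤ → Submodule ℂ E) [∀ l, (V l).HasOrthogonalProjection]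
    (S : Finset ℤ) (f : ℤ → ℝ) : E →L[ℂ] E :=
  ∑ l ∈ S, (f l : ℂ) • (V l).starProjection

theorem diagonal_apply (S : Finset ℤ) (f : ℤ → ℝ) (x : E) :
    diagonal V S f x = ∑ l ∈ S, (f l : ℂ) • (V l).starProjection x := by
  simp [diagonal]

theorem window_apply (Λ : ℝ) (x : E) :
    window V Λ x = ∑ l ∈ Finset.Icc ⌈-Λ⌉ ⌊Λ⌋, (V l).starProjection x := by
  simp [window]

theorem mem_Icc_iff_abs_le {Λ : ℝ} {l : ℤ} :
    l ∈ Finset.Icc ⌈-Λ⌉ ⌊Λ⌋ ↔ |(l : ℝ)| ≤ Λ := by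
  rw [Finset.mem_Icc, Int.ceil_le, Int.le_floor, abs_le]

theorem starProjection_self_apply (l : ℤ) (x : E) :
    (V l).starProjection ((V l).starProjection x) = (V l).starProjection x :=
  Submodule.starProjection_eq_self_iff.mpr (Submodule.starProjection_apply_mem _ _)

theorem re_inner_starProjection (l : ℤ) (x : E) :
    (⟪x, (V l).starProjection x⟫_ℂ).re = ‖(V l).starProjection x‖ ^ 2 := by
  have h := starProjection_self_apply (V := V) l x
  nth_rewrite 1 [← h]
  rw [← Submodule.inner_starProjection_left_eq_right]
  exact inner_self_eq_norm_sq (𝕜 := ℂ) _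

theorem inner_window_left (Λ : ℝ) (x y : E) : ⟪window V Λ x, y⟫_ℂ = ⟪x, window V Λ y⟫_ℂ := by
  rw [window_apply, window_apply, inner_sum, sum_inner]
  exact Finset.sum_congr rfl fun l _ => Submodule.inner_starProjection_left_eq_right _ _ _

variable [CompleteSpace E] (hV : IsHilbertSum ℂ (fun l => V l) fun l => (V l).subtypeₗᵢ)
include hV

theorem starProjection_starProjection_of_ne {l m : ℤ} (h : l ≠ m) (x : E) :
    (V l).starProjection ((V m).starProjection x) = 0 := by
  rw [Submodule.starProjection_apply_eq_zero_iff]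
  intro w hw
  exact hV.OrthogonalFamily h ⟨w, hw⟩ ⟨_, Submodule.starProjection_apply_mem (V m) x⟩

theorem starProjection_starProjection (l m : ℤ) (x : E) :
    (V l).starProjection ((V m).starProjection x) =
      if l = m then (V m).starProjection x else 0 := by
  split_ifs with h
  · rw [h, starProjection_self_apply]
  · exact starProjection_starProjection_of_ne hV h x

theorem starProjection_diagonal {S : Finset ℤ} {f : ℤ → ℝ} (hf : ∀ l ∉ S, f l = 0) (m : ℤ)
    (x : E) : (V m).starProjection (diagonal V S f x) = (f m : ℂ) • (V m).starProjection x := by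
  rw [diagonal_apply, map_sum]
  simp only [map_smul, starProjection_starProjection hV, smul_ite, smul_zero, Finset.sum_ite_eq]
  split_ifs with h
  · rfl
  · simp [hf m h]

theorem starProjection_window (Λ : ℝ) (m : ℤ) (x : E) :
    (V m).starProjection (window V Λ x) = if |(m : ℝ)| ≤ Λ then (V m).starProjection x else 0 := by
  rw [window_apply, map_sum]
  simp only [starProjection_starProjection hV, Finset.sum_ite_eq, mem_Icc_iff_abs_le]

theorem window_starProjection {Λ : ℝ} {m : ℤ} (hm : |(m : ℝ)| ≤ Λ) (x : E) :
    window V Λ ((V m).starProjection x) = (V m).starProjection x := by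
  rw [window_apply]
  simp only [starProjection_starProjection hV, Finset.sum_ite_eq', mem_Icc_iff_abs_le, if_pos hm]

theorem hasSum_starProjection (x : E) : HasSum (fun l => (V l).starProjection x) x := by
  have h := hV.hasSum_linearIsometryEquiv_symm (hV.linearIsometryEquiv x)
  rw [LinearIsometryEquiv.symm_apply_apply] at h
  convert h using 2 with m
  have h1 := h.mapL (V m).starProjection
  have h2 := hasSum_single (f := fun l => (V m).starProjection
    ((V l).subtypeₗᵢ (hV.linearIsometryEquiv x l))) m (by
      intro l hl
      rw [Submodule.starProjection_apply_eq_zero_iff]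
      intro w hw
      exact hV.OrthogonalFamily hl.symm ⟨w, hw⟩ _)
  rw [h1.unique h2]
  exact Submodule.starProjection_eq_self_iff.mpr (hV.linearIsometryEquiv x m).2

theorem hasSum_norm_sq_starProjection (x : E) :
    HasSum (fun l => ‖(V l).starProjection x‖ ^ 2) (‖x‖ ^ 2) := by
  have h := ((hasSum_starProjection hV x).mapL (innerSL ℂ x)).mapL Complex.reCLM
  convert h using 2 with l
  · simp only [innerSL_apply_apply, Complex.reCLM_apply]
    exact (re_inner_starProjection l x).symm
  · simp only [innerSL_apply_apply, Complex.reCLM_apply]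
    exact (inner_self_eq_norm_sq (𝕜 := ℂ) x).symm

theorem eq_sum_starProjection {S : Finset ℤ} {x : E} (h : ∀ l ∉ S, (V l).starProjection x = 0) :
    x = ∑ l ∈ S, (V l).starProjection x :=
  (hasSum_starProjection hV x).unique (hasSum_sum_of_ne_finset_zero h)

end HilbertSum

/-! ### The commutator of the Hamiltonian with a diagonal weight -/

section Commutator

variable {E : Type*} [NormedAddCommGroup E] [InnerProductSpace ℂ E] [CompleteSpace E]
  {V : ℤ → Submodule ℂ E} [∀ l, (V l).HasOrthogonalProjection]
  {H HW HR : E →ₗ.[ℂ] E} {χ r : ℝ}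

/-- `W l` is the bounded operator `H_W Π_l`. -/
structure IsHopping (V : ℤ → Submodule ℂ E) [∀ l, (V l).HasOrthogonalProjection]
    (HW : E →ₗ.[ℂ] E) (χ r : ℝ) (W : ℤ → E →L[ℂ] E) : Prop where
  apply : ∀ l x, ∃ hx : (V l).starProjection x ∈ HW.domain,
    HW ⟨(V l).starProjection x, hx⟩ = W l x
  norm_le : ∀ l x, ‖W l x‖ ≤ χ * (|(l : ℝ)| + 1) ^ r * ‖(V l).starProjection x‖

/-- The window of radius `|l|` fixes `Π_l x`, so the norm hypothesis applied to `Π_l x` gives the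
bound in terms of `‖Π_l x‖`. -/
theorem IsFrameworkHamiltonian.exists_isHopping (h : IsFrameworkHamiltonian V H HW HR χ r) :
    ∃ W, IsHopping V HW χ r W := by
  have key : ∀ (l : ℤ) (x : E), ∃ hx : (V l).starProjection x ∈ HW.domain,
      ‖HW ⟨(V l).starProjection x, hx⟩‖ ≤ χ * (|(l : ℝ)| + 1) ^ r * ‖(V l).starProjection x‖ := by
    intro l x
    have hl : ((l.natAbs : ℕ) : ℝ) = |(l : ℝ)| := by rw [Nat.cast_natAbs, Int.cast_abs]
    obtain ⟨hx, hb⟩ := h.norm_le l.natAbs ((V l).starProjection x)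
    have hw := window_starProjection h.hilbertSum (Λ := (l.natAbs : ℝ)) hl.ge x
    simp only [hw] at hx hb
    rw [← hl]
    exact ⟨hx, hb⟩
  choose hmem hb using key
  let T : ℤ → E →ₗ[ℂ] E := fun l =>
    HW.toFun ∘ₗ LinearMap.codRestrict HW.domain ((V l).starProjection : E →ₗ[ℂ] E) (hmem l)
  have hT : ∀ l x, T l x = HW ⟨(V l).starProjection x, hmem l x⟩ := fun l x => rfl
  have hc : ∀ l : ℤ, 0 ≤ χ * (|(l : ℝ)| + 1) ^ r := fun l =>
    mul_nonneg h.chi_pos.le (by positivity)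
  exact ⟨fun l => (T l).mkContinuous (χ * (|(l : ℝ)| + 1) ^ r) fun x =>
      (hb l x).trans (mul_le_mul_of_nonneg_left (Submodule.norm_starProjection_apply_le _ _) (hc l)),
    fun l x => ⟨hmem l x, rfl⟩, fun l x => hb l x⟩

namespace IsHopping

variable {W : ℤ → E →L[ℂ] E} (hW : IsHopping V HW χ r W)
  (h : IsFrameworkHamiltonian V H HW HR χ r)
include hW h

theorem starProjection_apply_eq_zero {l m : ℤ} (hlm : 1 < |m - l|) (x : E) :
    (V m).starProjection (W l x) = 0 := by
  obtain ⟨hx, he⟩ := hW.apply l x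
  rw [← he]
  exact h.hop m l hlm x hx

theorem apply_starProjection_of_ne {l m : ℤ} (hlm : l ≠ m) (x : E) :
    W l ((V m).starProjection x) = 0 := by
  have hb := hW.norm_le l ((V m).starProjection x)
  rw [starProjection_starProjection_of_ne h.hilbertSum hlm, norm_zero, mul_zero] at hb
  exact norm_le_zero_iff.mp hb

theorem inner_apply_starProjection (l m : ℤ) (x y : E) :
    ⟪W l x, (V m).starProjection y⟫_ℂ = ⟪(V l).starProjection x, W m y⟫_ℂ := by
  obtain ⟨hx, ex⟩ := hW.apply l x
  obtain ⟨hy, ey⟩ := hW.apply m y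
  rw [← ex, ← ey]
  exact h.symmetric_W ⟨_, hx⟩ ⟨_, hy⟩

/-- Formally `(H_W Π_m)* = Π_m H_W`, where only the blocks next to `m` contribute. -/
theorem adjoint_apply (m : ℤ) (x : E) :
    (W m).adjoint x = ∑ l ∈ Finset.Icc (m - 1) (m + 1), (V m).starProjection (W l x) := by
  refine ext_inner_right ℂ fun v => ?_
  have hsupp : ∀ l ∉ Finset.Icc (m - 1) (m + 1), (V l).starProjection (W m v) = 0 := by
    intro l hl
    apply hW.starProjection_apply_eq_zero h
    rw [Finset.mem_Icc, not_and_or, not_le, not_le] at hl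
    rw [lt_abs]
    omega
  rw [ContinuousLinearMap.adjoint_inner_left, eq_sum_starProjection h.hilbertSum hsupp, inner_sum,
    sum_inner]
  refine Finset.sum_congr rfl fun l _ => ?_
  rw [← Submodule.inner_starProjection_left_eq_right,
    Submodule.inner_starProjection_left_eq_right (V m), hW.inner_apply_starProjection h]

theorem starProjection_adjoint_of_ne {l m : ℤ} (hlm : l ≠ m) (x : E) :
    (V m).starProjection ((W l).adjoint x) = 0 := by
  refine ext_inner_right ℂ fun v => ?_
  rw [Submodule.inner_starProjection_left_eq_right, ContinuousLinearMap.adjoint_inner_left,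
    hW.apply_starProjection_of_ne h hlm, inner_zero_right, inner_zero_left]

/-- The components of an eigenvector lie in the domain of the Hamiltonian. -/
theorem apply_component {Ψ : E} {e : ℝ} (hΨ : Ψ ∈ eigenspace H (e : ℂ)) (l : ℤ) :
    ∃ hx : (V l).starProjection Ψ ∈ H.domain, H ⟨(V l).starProjection Ψ, hx⟩ =
      (e : ℂ) • (V l).starProjection Ψ + (W l Ψ - (W l).adjoint Ψ) := by
  obtain ⟨hd, he⟩ := mem_eigenspace_iff.mp hΨ
  have hH : ∀ x : E, ∀ hR : (V l).starProjection x ∈ HR.domain,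
      ∃ hx : (V l).starProjection x ∈ H.domain,
        H ⟨_, hx⟩ = W l x + HR ⟨(V l).starProjection x, hR⟩ := by
    intro x hR
    obtain ⟨hw, ew⟩ := hW.apply l x
    have hm : (V l).starProjection x ∈ (HW + HR).domain := ⟨hw, hR⟩
    refine ⟨h.sum_le.1 hm, ?_⟩
    rw [← ew]
    exact (h.sum_le.2 (x := ⟨_, hm⟩) (y := ⟨_, h.sum_le.1 hm⟩) rfl).symm
  -- Testing the eigenvalue equation against `Π_l v` puts `Π_l Ψ` into the domain of the adjoint of
  -- `H_R`, which is `H_R` itself.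
  have hadj : ∀ v : HR.domain,
      ⟪(e : ℂ) • (V l).starProjection Ψ - (W l).adjoint Ψ, (v : E)⟫_ℂ =
        ⟪(V l).starProjection Ψ, HR v⟫_ℂ := by
    intro v
    obtain ⟨hv, ev⟩ := h.commute l v
    obtain ⟨hv', ev'⟩ := hH v hv
    have h1 := isFormalAdjoint_self h.selfAdjoint ⟨Ψ, hd⟩ ⟨_, hv'⟩
    rw [he, ev', inner_add_right, ev, inner_smul_left] at h1
    rw [inner_sub_left, inner_smul_left, Submodule.inner_starProjection_left_eq_right, h1,
      ContinuousLinearMap.adjoint_inner_left, Submodule.inner_starProjection_left_eq_right]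
    ring
  have hR : (V l).starProjection Ψ ∈ HR.adjoint.domain :=
    LinearPMap.mem_adjoint_domain_of_exists _ ⟨_, hadj⟩
  have hRe := LinearPMap.adjoint_apply_eq h.selfAdjoint_R.dense_domain ⟨_, hR⟩ hadj
  have hR' : ∃ hR : (V l).starProjection Ψ ∈ HR.domain,
      HR ⟨_, hR⟩ = (e : ℂ) • (V l).starProjection Ψ - (W l).adjoint Ψ := by
    have hsa : HR.adjoint = HR := LinearPMap.isSelfAdjoint_def.mp h.selfAdjoint_R
    generalize HR.adjoint = A at hsa hR hRe
    subst hsa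
    exact ⟨hR, hRe⟩
  obtain ⟨hR, eR⟩ := hR'
  obtain ⟨hx, ex⟩ := hH Ψ hR
  refine ⟨hx, ?_⟩
  rw [ex, eR]
  abel

/-- The identity `(H - e) F Ψ = [H_W, F] Ψ`; finite support of the weight keeps `F Ψ` in the domain.
-/
theorem apply_diagonal {Ψ : E} {e : ℝ} (hΨ : Ψ ∈ eigenspace H (e : ℂ)) (S : Finset ℤ)
    (f : ℤ → ℝ) :
    ∃ hx : diagonal V S f Ψ ∈ H.domain, H ⟨diagonal V S f Ψ, hx⟩ - (e : ℂ) • diagonal V S f Ψ =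
      ∑ l ∈ S, (f l : ℂ) • (W l Ψ - (W l).adjoint Ψ) := by
  choose hm he using hW.apply_component h hΨ
  have hx : diagonal V S f Ψ ∈ H.domain := by
    rw [diagonal_apply]
    exact H.domain.sum_mem fun l _ => H.domain.smul_mem _ (hm l)
  refine ⟨hx, ?_⟩
  have h1 : (⟨diagonal V S f Ψ, hx⟩ : H.domain) =
      ∑ l ∈ S, (f l : ℂ) • ⟨(V l).starProjection Ψ, hm l⟩ := by
    apply Subtype.ext
    simp [diagonal_apply]
  have h2 : H ⟨diagonal V S f Ψ, hx⟩ =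
      ∑ l ∈ S, (f l : ℂ) • H ⟨(V l).starProjection Ψ, hm l⟩ := by
    rw [h1]
    change H.toFun _ = _
    rw [map_sum]
    exact Finset.sum_congr rfl fun l _ => H.toFun.map_smul _ _
  rw [h2, diagonal_apply, Finset.smul_sum, ← Finset.sum_sub_distrib]
  refine Finset.sum_congr rfl fun l _ => ?_
  rw [he, smul_add, smul_comm (e : ℂ)]
  abel

theorem starProjection_commutator {S : Finset ℤ} {f : ℤ → ℝ} (hf : ∀ l ∉ S, f l = 0) (m : ℤ)
    (x : E) :
    (V m).starProjection (∑ l ∈ S, (f l : ℂ) • (W l x - (W l).adjoint x)) =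
      ∑ l ∈ Finset.Icc (m - 1) (m + 1), ((f l : ℂ) - f m) • (V m).starProjection (W l x) := by
  have h1 : ∑ l ∈ S, (f l : ℂ) • (V m).starProjection (W l x) =
      ∑ l ∈ Finset.Icc (m - 1) (m + 1), (f l : ℂ) • (V m).starProjection (W l x) := by
    rw [Finset.sum_subset (s₁ := S)
        (Finset.subset_union_left (s₂ := Finset.Icc (m - 1) (m + 1))),
      Finset.sum_subset (s₁ := Finset.Icc (m - 1) (m + 1)) (Finset.subset_union_right (s₁ := S))]
    · intro l _ hl
      rw [hW.starProjection_apply_eq_zero h, smul_zero]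
      rw [Finset.mem_Icc, not_and_or, not_le, not_le] at hl
      rw [lt_abs]
      omega
    · intro l _ hl
      rw [hf l hl, Complex.ofReal_zero, zero_smul]
  have h2 : ∑ l ∈ S, (f l : ℂ) • (V m).starProjection ((W l).adjoint x) =
      (f m : ℂ) • ∑ l ∈ Finset.Icc (m - 1) (m + 1), (V m).starProjection (W l x) := by
    rw [Finset.sum_eq_single m]
    · rw [hW.adjoint_apply h, map_sum]
      simp only [starProjection_self_apply]
    · intro l _ hl
      rw [hW.starProjection_adjoint_of_ne h hl, smul_zero]
    · intro hm
      rw [hf m hm, Complex.ofReal_zero, zero_smul]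
  simp only [map_sum, map_smul, map_sub, smul_sub, Finset.sum_sub_distrib, h1, h2, sub_smul,
    Finset.smul_sum]

/-- Component `m` of the commutator receives only from `m - 1` and `m + 1`, as the diagonal term
cancels. Of the constant `8`, one factor `2` comes from squaring the sum of the two neighbours, one
from squaring `η f + κ`, and one from adding the two shifted series. -/
theorem norm_commutator_sq_le {S : Finset ℤ} {f : ℤ → ℝ} (hf : ∀ l ∉ S, f l = 0) {η κ : ℝ}
    (hf0 : ∀ l, 0 ≤ f l)
    (hfr : ∀ l m : ℤ, |l - m| = 1 → |f l - f m| * (χ * (|(l : ℝ)| + 1) ^ r) ≤ η * f l + κ) (x : E) :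
    ‖∑ l ∈ S, (f l : ℂ) • (W l x - (W l).adjoint x)‖ ^ 2 ≤
      8 * (η ^ 2 * ‖diagonal V S f x‖ ^ 2 + κ ^ 2 * ‖x‖ ^ 2) := by
  set k := ∑ l ∈ S, (f l : ℂ) • (W l x - (W l).adjoint x) with hk
  let b : ℤ → ℝ := fun l => (η * f l + κ) * ‖(V l).starProjection x‖
  have hterm : ∀ l m : ℤ, |l - m| = 1 →
      ‖((f l : ℂ) - f m) • (V m).starProjection (W l x)‖ ≤ b l := by
    intro l m hlm
    rw [norm_smul, ← Complex.ofReal_sub, Complex.norm_real, Real.norm_eq_abs]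
    calc |f l - f m| * ‖(V m).starProjection (W l x)‖
        ≤ |f l - f m| * (χ * (|(l : ℝ)| + 1) ^ r * ‖(V l).starProjection x‖) :=
          mul_le_mul_of_nonneg_left
            ((Submodule.norm_starProjection_apply_le _ _).trans (hW.norm_le l x)) (abs_nonneg _)
      _ = |f l - f m| * (χ * (|(l : ℝ)| + 1) ^ r) * ‖(V l).starProjection x‖ := by ring
      _ ≤ b l := mul_le_mul_of_nonneg_right (hfr l m hlm) (norm_nonneg _)
  have hcomp : ∀ m, ‖(V m).starProjection k‖ ≤ b (m - 1) + b (m + 1) := by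
    intro m
    have hIcc : Finset.Icc (m - 1) (m + 1) = {m - 1, m, m + 1} := by
      ext l; simp only [Finset.mem_Icc, Finset.mem_insert, Finset.mem_singleton]; omega
    rw [hk, hW.starProjection_commutator h hf, hIcc,
      Finset.sum_insert (by simp; omega), Finset.sum_insert (by simp), Finset.sum_singleton, sub_self,
      zero_smul, zero_add]
    exact (norm_add_le _ _).trans (add_le_add (hterm _ _ (by simp)) (hterm _ _ (by simp)))
  have hd := (hasSum_norm_sq_starProjection h.hilbertSum (diagonal V S f x)).mul_left (η ^ 2)
  have hx := (hasSum_norm_sq_starProjection h.hilbertSum x).mul_left (κ ^ 2)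
  have hsum := ((hd.add hx).mul_left 2)
  have hbsq : ∀ l, b l ^ 2 ≤ 2 * (η ^ 2 * ‖(V l).starProjection (diagonal V S f x)‖ ^ 2 +
      κ ^ 2 * ‖(V l).starProjection x‖ ^ 2) := by
    intro l
    rw [starProjection_diagonal h.hilbertSum hf, norm_smul, Complex.norm_real, Real.norm_eq_abs,
      abs_of_nonneg (hf0 l)]
    have : 0 ≤ (η * f l - κ) ^ 2 * ‖(V l).starProjection x‖ ^ 2 := by positivity
    simp only [b]
    nlinarith
  have h1 := (Equiv.subRight (1 : ℤ)).hasSum_iff.mpr hsum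
  have h2 := (Equiv.addRight (1 : ℤ)).hasSum_iff.mpr hsum
  refine (hasSum_le (fun m => ?_) (hasSum_norm_sq_starProjection h.hilbertSum k)
    ((h1.add h2).mul_left 2)).trans (le_of_eq (by ring))
  have hm1 := hbsq (m - 1)
  have hm2 := hbsq (m + 1)
  simp only [Function.comp_apply, Equiv.subRight_apply, Equiv.coe_addRight]
  have h3 : ‖(V m).starProjection k‖ ^ 2 ≤ (b (m - 1) + b (m + 1)) ^ 2 :=
    pow_le_pow_left₀ (norm_nonneg _) (hcomp m) 2
  nlinarith [sq_nonneg (b (m - 1) - b (m + 1))]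

end IsHopping

end Commutator

/-! ### Construction of the slowly varying weight -/

section Weight

/-- Truncation of a real number to the interval `[0, T]`. -/
noncomputable def clamp (T s : ℝ) : ℝ := max 0 (min T s)

theorem clamp_nonneg (T s : ℝ) : 0 ≤ clamp T s := le_max_left _ _

theorem clamp_le {T : ℝ} (hT : 0 ≤ T) (s : ℝ) : clamp T s ≤ T := max_le hT (min_le_left _ _)

theorem clamp_of_nonpos {s : ℝ} (T : ℝ) (hs : s ≤ 0) : clamp T s = 0 :=
  max_eq_left ((min_le_right _ _).trans hs)

theorem clamp_of_le {T s : ℝ} (hT : 0 ≤ T) (hs : T ≤ s) : clamp T s = T := by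
  rw [clamp, min_eq_left hs, max_eq_right hT]

theorem abs_clamp_sub_clamp_le (T s t : ℝ) : |clamp T s - clamp T t| ≤ |s - t| := by
  simp only [clamp, max_def, min_def, abs_le]
  rcases abs_cases (s - t) with h | h <;> split_ifs <;> constructor <;> linarith

/-- The discrete form of `d(x ^ (1 - r)) ≤ x ^ (-r) dx`: for `u ≤ v ≤ u + 1`, `v ^ (1 - r) * u ^ r -
u ≤ v - u ≤ 1`. -/
theorem abs_rpow_sub_rpow_mul_le {r x y : ℝ} (hr0 : 0 ≤ r) (hr1 : r ≤ 1) (hx : 2 ≤ x) (hy : 2 ≤ y)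
    (hxy : |x - y| ≤ 1) : |x ^ (1 - r) - y ^ (1 - r)| * (x - 1) ^ r ≤ 1 := by
  have key : ∀ u v : ℝ, 2 ≤ u → u ≤ v → v ≤ u + 1 →
      |v ^ (1 - r) - u ^ (1 - r)| * u ^ r ≤ 1 := by
    intro u v hu huv hvu
    have hu0 : 0 < u := by linarith
    have hv0 : 0 < v := by linarith
    rw [abs_of_nonneg (sub_nonneg.mpr (Real.rpow_le_rpow hu0.le huv (by linarith))), sub_mul,
      ← Real.rpow_add hu0, sub_add_cancel, Real.rpow_one]
    have h1 : v ^ (1 - r) * u ^ r ≤ v ^ (1 - r) * v ^ r :=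
      mul_le_mul_of_nonneg_left (Real.rpow_le_rpow hu0.le huv hr0) (by positivity)
    rw [← Real.rpow_add hv0, sub_add_cancel, Real.rpow_one] at h1
    linarith
  rw [abs_le] at hxy
  rcases le_total x y with h | h
  · rw [abs_sub_comm]
    refine (mul_le_mul_of_nonneg_left ?_ (abs_nonneg _)).trans (key x y hx h (by linarith))
    exact Real.rpow_le_rpow (by linarith) (by linarith) hr0
  · refine (mul_le_mul_of_nonneg_left ?_ (abs_nonneg _)).trans (key y x hy h (by linarith))
    exact Real.rpow_le_rpow (by linarith) (by linarith) hr0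

/-- The logarithm is unbounded, yet its unit steps are small against `x ^ r`: this permits an
arbitrarily slow cutoff to finite support. -/
theorem abs_log_sub_log_mul_le {r x y : ℝ} (hr1 : r ≤ 1) (hx : 2 ≤ x) (hy : 2 ≤ y)
    (hxy : |x - y| ≤ 1) : |Real.log x - Real.log y| * (x - 1) ^ r ≤ 1 := by
  have key : ∀ u v : ℝ, 2 ≤ u → u ≤ v → v ≤ u + 1 → |Real.log v - Real.log u| * u ≤ 1 := by
    intro u v hu huv hvu
    have hu0 : 0 < u := by linarith
    have hv0 : 0 < v := by linarith
    rw [abs_of_nonneg (sub_nonneg.mpr (Real.log_le_log hu0 huv)), ← Real.log_div hv0.ne' hu0.ne',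
      ← le_div_iff₀ hu0]
    refine (Real.log_le_sub_one_of_pos (div_pos hv0 hu0)).trans ?_
    rw [div_sub_one hu0.ne']
    exact div_le_div_of_nonneg_right (by linarith) hu0.le
  have hpow : (x - 1) ^ r ≤ x - 1 := by
    simpa using Real.rpow_le_rpow_of_exponent_le (by linarith : 1 ≤ x - 1) hr1
  rw [abs_le] at hxy
  rcases le_total x y with h | h
  · rw [abs_sub_comm]
    exact (mul_le_mul_of_nonneg_left (by linarith) (abs_nonneg _)).trans
      (key x y hx h (by linarith))
  · exact (mul_le_mul_of_nonneg_left (by linarith) (abs_nonneg _)).trans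
      (key y x hy h (by linarith))

/-- A finitely supported weight which grows like `exp (a |l| ^ (1 - r))` between two thresholds and
then decays so slowly that its commutator with a hopping term of size `χ (|l| + 1) ^ r` is small. -/
theorem exists_weight {χ r a T κ Λ₀ N : ℝ} (hχ : 0 < χ) (hr0 : 0 ≤ r) (hr1 : r < 1) (ha : 0 < a)
    (ha1 : a ≤ 1) (hT : 0 ≤ T) (hκ : 0 < κ) :
    ∃ (f : ℤ → ℝ) (S : Finset ℤ), (∀ l ∉ S, f l = 0) ∧ (∀ l, 0 ≤ f l) ∧
      (∀ l : ℤ, |(l : ℝ)| ≤ Λ₀ → f l ≤ 1) ∧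
      (∀ l : ℤ, |(l : ℝ)| ≤ N → (Λ₀ + 2) ^ (1 - r) + T ≤ (|(l : ℝ)| + 2) ^ (1 - r) →
        f l = Real.exp (a * T)) ∧
      ∀ l m : ℤ, |l - m| = 1 →
        |f l - f m| * (χ * (|(l : ℝ)| + 1) ^ r) ≤ 2 * a * χ * f l + κ := by
  set M := Real.exp (a * T) with hM
  have hMpos : 0 < M := Real.exp_pos _
  -- Chosen so that the cutoff contributes at most `M χ c = κ` to the commutator bound.
  set c := κ / (M * χ) with hc
  have hcpos : 0 < c := by positivity
  -- The shift by `2` makes `|l| + 1` at most both `|l| + 2` and its neighbour `|m| + 2`, so the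
  -- hopping factor is controlled whichever way the step goes.
  let p : ℤ → ℝ := fun l => clamp T ((|(l : ℝ)| + 2) ^ (1 - r) - (Λ₀ + 2) ^ (1 - r))
  let w : ℤ → ℝ := fun l => Real.exp (a * p l)
  let g : ℤ → ℝ := fun l => clamp 1 (1 - c * (Real.log (|(l : ℝ)| + 2) - Real.log (N + 2)))
  have hw0 : ∀ l, 0 < w l := fun l => Real.exp_pos _
  have hwM : ∀ l, w l ≤ M := fun l =>
    Real.exp_le_exp.mpr (mul_le_mul_of_nonneg_left (clamp_le hT _) ha.le)
  have hg0 : ∀ l, 0 ≤ g l := fun l => clamp_nonneg _ _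
  have hg1 : ∀ l, g l ≤ 1 := fun l => clamp_le zero_le_one _
  -- Beyond this radius the logarithmic cutoff `g` has reached zero.
  set B := Real.exp (1 / c + Real.log (N + 2)) with hB
  refine ⟨fun l => w l * g l, Finset.Icc ⌈-B⌉ ⌊B⌋, ?_, fun l => mul_nonneg (hw0 l).le (hg0 l),
    ?_, ?_, ?_⟩
  · intro l hl
    rw [mem_Icc_iff_abs_le, not_le] at hl
    have h1 : 1 / c + Real.log (N + 2) ≤ Real.log (|(l : ℝ)| + 2) := by
      rw [Real.le_log_iff_exp_le (by positivity)]
      linarith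
    have h2 : 1 ≤ c * (Real.log (|(l : ℝ)| + 2) - Real.log (N + 2)) := by
      rw [← div_le_iff₀' hcpos]; linarith
    have h3 : g l = 0 := clamp_of_nonpos _ (by linarith)
    simp only [h3, mul_zero]
  · intro l hl
    have h1 : p l = 0 := clamp_of_nonpos _ (by
      have := Real.rpow_le_rpow (by positivity) (add_le_add_left hl 2)
        (by linarith : 0 ≤ 1 - r)
      linarith)
    have h2 : w l = 1 := by simp only [w, h1, mul_zero, Real.exp_zero]
    simp only [h2, one_mul]
    exact hg1 l
  · intro l hl hl2
    have h1 : p l = T := clamp_of_le hT (by linarith)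
    have h2 : g l = 1 := clamp_of_le zero_le_one (by
      have := Real.log_le_log (by positivity) (add_le_add_left hl 2)
      have := mul_nonneg hcpos.le (sub_nonneg.mpr this)
      linarith)
    simp only [w, h1, h2, mul_one, hM]
  · intro l m hlm
    set x := |(l : ℝ)| + 2 with hx
    set y := |(m : ℝ)| + 2 with hy
    have hx2 : 2 ≤ x := by have := abs_nonneg (l : ℝ); linarith
    have hy2 : 2 ≤ y := by have := abs_nonneg (m : ℝ); linarith
    have hxy : |x - y| ≤ 1 := by
      have h1 := abs_abs_sub_abs_le_abs_sub (l : ℝ) (m : ℝ)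
      have h2 : |(l : ℝ) - m| = 1 := by exact_mod_cast hlm
      rw [hx, hy, add_sub_add_right_eq_sub]
      linarith
    have hx1 : |(l : ℝ)| + 1 = x - 1 := by rw [hx]; ring
    set q := (x - 1) ^ r with hq
    have hq1 : 1 ≤ q := Real.one_le_rpow (by linarith) hr0
    have hp : |p m - p l| * q ≤ 1 := by
      have h1 : |p l - p m| ≤ |x ^ (1 - r) - y ^ (1 - r)| := by
        refine (abs_clamp_sub_clamp_le _ _ _).trans (le_of_eq ?_)
        rw [sub_sub_sub_cancel_right]
      rw [abs_sub_comm]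
      exact (mul_le_mul_of_nonneg_right h1 (by linarith)).trans
        (abs_rpow_sub_rpow_mul_le hr0 hr1.le hx2 hy2 hxy)
    have hg : |g l - g m| * q ≤ c := by
      have h1 : |g l - g m| ≤ c * |Real.log x - Real.log y| := by
        refine (abs_clamp_sub_clamp_le _ _ _).trans (le_of_eq ?_)
        rw [← abs_of_pos hcpos, ← abs_mul, abs_of_pos hcpos, ← abs_neg]
        congr 1; ring
      calc |g l - g m| * q ≤ c * |Real.log x - Real.log y| * q :=
            mul_le_mul_of_nonneg_right h1 (by linarith)
        _ = c * (|Real.log x - Real.log y| * q) := by ring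
        _ ≤ c * 1 := mul_le_mul_of_nonneg_left
            (abs_log_sub_log_mul_le hr1.le hx2 hy2 hxy) hcpos.le
        _ = c := mul_one c
    have hw : |w l - w m| * q ≤ 2 * a * w l := by
      have hp1 : |p m - p l| ≤ 1 :=
        (le_mul_of_one_le_right (abs_nonneg _) hq1).trans hp
      have hs : |a * (p m - p l)| = a * |p m - p l| := by rw [abs_mul, abs_of_pos ha]
      have h1 := Real.abs_exp_sub_one_le (x := a * (p m - p l)) (by
        rw [hs]; exact mul_le_one₀ ha1 (abs_nonneg _) hp1)
      have h2 : |w l - w m| = w l * |Real.exp (a * (p m - p l)) - 1| := by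
        have : w m = w l * Real.exp (a * (p m - p l)) := by
          simp only [w]; rw [← Real.exp_add]; congr 1; ring
        rw [this, abs_sub_comm, ← mul_sub_one, abs_mul, abs_of_pos (hw0 l)]
      rw [hs] at h1
      calc |w l - w m| * q = w l * (|Real.exp (a * (p m - p l)) - 1| * q) := by rw [h2]; ring
        _ ≤ w l * (2 * (a * |p m - p l|) * q) := mul_le_mul_of_nonneg_left
            (mul_le_mul_of_nonneg_right h1 (by linarith)) (hw0 l).le
        _ = 2 * a * w l * (|p m - p l| * q) := by ring
        _ ≤ 2 * a * w l * 1 := mul_le_mul_of_nonneg_left hp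
            (mul_nonneg (by linarith) (hw0 l).le)
        _ = 2 * a * w l := mul_one _
    have hsplit : |w l * g l - w m * g m| ≤ |w l - w m| * g l + w m * |g l - g m| := by
      have : w l * g l - w m * g m = (w l - w m) * g l + w m * (g l - g m) := by ring
      rw [this]
      refine (abs_add_le _ _).trans (le_of_eq ?_)
      rw [abs_mul, abs_mul, abs_of_nonneg (hg0 l), abs_of_pos (hw0 m)]
    rw [hx1]
    calc |w l * g l - w m * g m| * (χ * q)
        ≤ (|w l - w m| * g l + w m * |g l - g m|) * (χ * q) :=
          mul_le_mul_of_nonneg_right hsplit (mul_nonneg hχ.le (by linarith))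
      _ = (|w l - w m| * q) * (χ * g l) + w m * χ * (|g l - g m| * q) := by ring
      _ ≤ 2 * a * w l * (χ * g l) + M * χ * c := by
          refine add_le_add (mul_le_mul_of_nonneg_right hw (mul_nonneg hχ.le (hg0 l))) ?_
          exact mul_le_mul (mul_le_mul_of_nonneg_right (hwM m) hχ.le) hg
            (mul_nonneg (abs_nonneg _) (by linarith)) (by positivity)
      _ = 2 * a * χ * (w l * g l) + κ := by
          rw [hc]; field_simp

end Weight

/-! ### Tail estimate for the eigenvector -/

section Tail

variable {E : Type*} [NormedAddCommGroup E] [InnerProductSpace ℂ E] [CompleteSpace E]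
  {V : ℤ → Submodule ℂ E} [∀ l, (V l).HasOrthogonalProjection]

theorem hasSum_norm_sub_window_sq (hV : IsHilbertSum ℂ (fun l => V l) fun l => (V l).subtypeₗᵢ)
    (Λ : ℝ) (x : E) :
    HasSum (fun l : ℤ => if |(l : ℝ)| ≤ Λ then 0 else ‖(V l).starProjection x‖ ^ 2)
      (‖x - window V Λ x‖ ^ 2) := by
  convert hasSum_norm_sq_starProjection hV (x - window V Λ x) using 2 with l
  rw [map_sub, starProjection_window hV]
  split_ifs <;> simp

theorem norm_le_of_norm_starProjection_le
    (hV : IsHilbertSum ℂ (fun l => V l) fun l => (V l).subtypeₗᵢ) {x y : E}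
    (h : ∀ l, ‖(V l).starProjection x‖ ≤ ‖(V l).starProjection y‖) : ‖x‖ ≤ ‖y‖ :=
  le_of_sq_le_sq (hasSum_le (fun l => pow_le_pow_left₀ (norm_nonneg _) (h l) 2)
    (hasSum_norm_sq_starProjection hV x) (hasSum_norm_sq_starProjection hV y)) (norm_nonneg _)

/-- Markov's inequality for the quantum number distribution. -/
theorem norm_sub_window_sq_le (hV : IsHilbertSum ℂ (fun l => V l) fun l => (V l).subtypeₗᵢ)
    {x : E} {lbar : ℝ}
    (hl : HasSum (fun l : ℤ => |(l : ℝ)| * ‖(V l).starProjection x‖ ^ 2) lbar) :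
    ‖x - window V (2 * lbar) x‖ ^ 2 ≤ 1 / 2 := by
  have h0 : 0 ≤ lbar := hl.nonneg fun l => by positivity
  rcases h0.eq_or_lt with h | h
  · subst h
    refine (hasSum_le (fun l => ?_) (hasSum_norm_sub_window_sq hV _ x) hl).trans (by norm_num)
    split_ifs with hc
    · positivity
    · have h1 : (1 : ℝ) ≤ |(l : ℝ)| := by
        rw [mul_zero, abs_nonpos_iff] at hc
        have : 1 ≤ |l| := Int.one_le_abs (by exact_mod_cast hc)
        exact_mod_cast this
      exact le_mul_of_one_le_left (by positivity) h1
  · refine (hasSum_le (fun l => ?_) (hasSum_norm_sub_window_sq hV _ x)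
      (hl.mul_left (2 * lbar)⁻¹)).trans (le_of_eq (by field_simp))
    split_ifs with hc
    · positivity
    · rw [← mul_assoc]
      refine le_mul_of_one_le_left (by positivity) ?_
      rw [← div_eq_inv_mul, one_le_div (by linarith)]
      exact (not_le.mp hc).le

variable {H HW HR : E →ₗ.[ℂ] E} {χ r : ℝ}

/-- The weighted norm of an isolated eigenvector is bounded, provided that the weight varies slowly
and does not exceed `1` on a window which carries half of the mass. -/
theorem norm_diagonal_le (h : IsFrameworkHamiltonian V H HW HR χ r) {Ψ : E} {e δ Λ₀ η κ : ℝ}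
    (hΨ1 : ‖Ψ‖ = 1) (hΨ : Ψ ∈ eigenspace H (e : ℂ))
    (hdim : Module.finrank ℂ (eigenspace H (e : ℂ)) = 1) (hδ : 0 < δ)
    (hgap : ∀ z ∈ spectrum H, z ≠ (e : ℂ) → δ ≤ ‖z - (e : ℂ)‖)
    (hmass : ‖Ψ - window V Λ₀ Ψ‖ ^ 2 ≤ 1 / 2) {S : Finset ℤ} {f : ℤ → ℝ} (hf : ∀ l ∉ S, f l = 0)
    (hf0 : ∀ l, 0 ≤ f l) (hf1 : ∀ l : ℤ, |(l : ℝ)| ≤ Λ₀ → f l ≤ 1) (hη0 : 0 ≤ η)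
    (hη : η ≤ δ / 32) (hκ0 : 0 ≤ κ) (hκ : κ ≤ δ / 4)
    (hfr : ∀ l m : ℤ, |l - m| = 1 → |f l - f m| * (χ * (|(l : ℝ)| + 1) ^ r) ≤ η * f l + κ) :
    ‖diagonal V S f Ψ‖ ≤ 8 := by
  obtain ⟨W, hW⟩ := h.exists_isHopping
  obtain ⟨hx, he⟩ := hW.apply_diagonal h hΨ S f
  have hgap' := gap_mul_norm_sub_le h.selfAdjoint hΨ1 hΨ hdim hgap ⟨_, hx⟩
  have hcomm := hW.norm_commutator_sq_le h hf hf0 hfr Ψ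
  rw [← he] at hcomm
  set x := diagonal V S f Ψ with hxdef
  set p := ‖x‖ with hp
  have hp0 : 0 ≤ p := norm_nonneg _
  simp only at hgap'
  by_contra! hlt
  -- Under the contradiction hypothesis `p > 8`, each of `η² p²` and `κ²` is at most `δ² p² / 1024`,
  -- and `8 * 2 / 1024 = (1 / 8)²`.
  have hdist : ‖x - ⟪Ψ, x⟫_ℂ • Ψ‖ ≤ p / 8 := by
    have h1 : (δ * ‖x - ⟪Ψ, x⟫_ℂ • Ψ‖) ^ 2 ≤ 8 * (η ^ 2 * p ^ 2 + κ ^ 2 * ‖Ψ‖ ^ 2) :=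
      (pow_le_pow_left₀ (by positivity) hgap' 2).trans hcomm
    have h2 : η ^ 2 * p ^ 2 ≤ (δ / 32) ^ 2 * p ^ 2 :=
      mul_le_mul_of_nonneg_right (pow_le_pow_left₀ hη0 hη 2) (by positivity)
    have h3 : κ ^ 2 ≤ (δ / 4) ^ 2 := pow_le_pow_left₀ hκ0 hκ 2
    have h4 : δ ^ 2 * 64 ≤ δ ^ 2 * p ^ 2 :=
      mul_le_mul_of_nonneg_left (by nlinarith) (by positivity)
    rw [hΨ1] at h1
    have h5 : (δ * ‖x - ⟪Ψ, x⟫_ℂ • Ψ‖) ^ 2 ≤ (δ * (p / 8)) ^ 2 := by nlinarith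
    exact le_of_mul_le_mul_left (le_of_sq_le_sq h5 (by positivity)) hδ
  have hinner : ‖⟪Ψ, x⟫_ℂ‖ ≤ 1 + ‖Ψ - window V Λ₀ Ψ‖ * p := by
    have h1 : ⟪Ψ, x⟫_ℂ = ⟪Ψ, window V Λ₀ x⟫_ℂ + ⟪Ψ - window V Λ₀ Ψ, x⟫_ℂ := by
      rw [inner_sub_left, inner_window_left]; ring
    have h2 : ‖window V Λ₀ x‖ ≤ ‖Ψ‖ := by
      refine norm_le_of_norm_starProjection_le h.hilbertSum fun l => ?_
      rw [starProjection_window h.hilbertSum]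
      split_ifs with hl
      · rw [hxdef, starProjection_diagonal h.hilbertSum hf, norm_smul, Complex.norm_real,
          Real.norm_eq_abs, abs_of_nonneg (hf0 l)]
        exact mul_le_of_le_one_left (norm_nonneg _) (hf1 l hl)
      · simp
    rw [h1]
    refine (norm_add_le _ _).trans (add_le_add ?_ (norm_inner_le_norm _ _))
    refine (norm_inner_le_norm _ _).trans ?_
    rw [hΨ1] at h2 ⊢
    linarith
  -- Since `1 / √2 ≤ 3 / 4`, the final inequality reads `p ≤ p / 8 + 1 + 3 p / 4`, that is `p ≤ 8`.
  have hs : ‖Ψ - window V Λ₀ Ψ‖ ≤ 3 / 4 :=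
    le_of_sq_le_sq (hmass.trans (by norm_num)) (by norm_num)
  have htri : p ≤ p / 8 + ‖⟪Ψ, x⟫_ℂ‖ := by
    calc p = ‖(x - ⟪Ψ, x⟫_ℂ • Ψ) + ⟪Ψ, x⟫_ℂ • Ψ‖ := by rw [sub_add_cancel]
      _ ≤ _ := (norm_add_le _ _).trans
        (add_le_add hdist (by rw [norm_smul, hΨ1, mul_one]))
  have := mul_le_mul_of_nonneg_right hs hp0
  linarith

/-- For each finite set `s` of quantum numbers, a weight that stays at `exp (a T)` on the part of
`s` outside the window bounds that part of the tail. The bound `8` depends neither on `s` nor on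
where the cutoff begins, so it passes to the whole sum. -/
theorem exp_mul_norm_sub_window_le (h : IsFrameworkHamiltonian V H HW HR χ r) {Ψ : E}
    {e δ Λ₀ a T Λ : ℝ} (hΨ1 : ‖Ψ‖ = 1) (hΨ : Ψ ∈ eigenspace H (e : ℂ))
    (hdim : Module.finrank ℂ (eigenspace H (e : ℂ)) = 1) (hδ : 0 < δ)
    (hgap : ∀ z ∈ spectrum H, z ≠ (e : ℂ) → δ ≤ ‖z - (e : ℂ)‖)
    (hmass : ‖Ψ - window V Λ₀ Ψ‖ ^ 2 ≤ 1 / 2) (ha0 : 0 < a) (ha1 : a ≤ 1)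
    (ha : 2 * a * χ ≤ δ / 32) (hT : 0 ≤ T) (hΛ : 0 ≤ Λ)
    (hΛT : (Λ₀ + 2) ^ (1 - r) + T ≤ Λ ^ (1 - r)) :
    Real.exp (a * T) * ‖Ψ - window V Λ Ψ‖ ≤ 8 := by
  refine le_of_sq_le_sq ?_ (by norm_num)
  rw [mul_pow]
  refine hasSum_le_of_sum_le ((hasSum_norm_sub_window_sq h.hilbertSum Λ Ψ).mul_left _) fun s => ?_
  obtain ⟨f, S, hf, hf0, hf1, hfe, hfr⟩ := exists_weight (Λ₀ := Λ₀) (N := ∑ l ∈ s, |(l : ℝ)|)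
    h.chi_pos h.r_nonneg h.r_lt_one ha0 ha1 hT (by positivity : 0 < δ / 4)
  have hbound := norm_diagonal_le h hΨ1 hΨ hdim hδ hgap hmass hf hf0 hf1
    (by have := h.chi_pos; positivity) ha (by positivity) le_rfl hfr
  refine (Finset.sum_le_sum fun l hl => ?_).trans ((sum_le_hasSum s (fun l _ => by positivity)
    (hasSum_norm_sq_starProjection h.hilbertSum (diagonal V S f Ψ))).trans
    (pow_le_pow_left₀ (norm_nonneg _) hbound 2))
  split_ifs with hc
  · rw [mul_zero]; positivity
  · have h1 : |(l : ℝ)| ≤ ∑ l ∈ s, |(l : ℝ)| :=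
      Finset.single_le_sum (f := fun l : ℤ => |(l : ℝ)|) (fun _ _ => abs_nonneg _) hl
    have h2 : Λ ^ (1 - r) ≤ (|(l : ℝ)| + 2) ^ (1 - r) :=
      Real.rpow_le_rpow hΛ (by linarith [not_le.mp hc]) (by linarith [h.r_lt_one])
    rw [starProjection_diagonal h.hilbertSum hf, hfe l h1 (hΛT.trans h2), norm_smul,
      Complex.norm_real, Real.norm_eq_abs, abs_of_pos (Real.exp_pos _), mul_pow]

end Tail

/-! ### Choice of the constants and conclusion -/

theorem add_two_rpow_le {x s : ℝ} (hx : 0 ≤ x) (hs0 : 0 ≤ s) (hs1 : s ≤ 1) :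
    (x + 2) ^ s ≤ x ^ s + 2 := by
  have h1 := Real.rpow_add_le_add_rpow hx zero_le_two hs0 hs1
  have h2 : (2 : ℝ) ^ s ≤ 2 := by
    simpa using Real.rpow_le_rpow_of_exponent_le one_le_two hs1
  linarith

end QuantumNumberTail

theorem mainTheorem3 :
    ∃ C : ℝ, 0 < C ∧
      ∀ {E : Type*} [NormedAddCommGroup E] [InnerProductSpace ℂ E] [CompleteSpace E]
        (V : ℤ → Submodule ℂ E) [∀ l, (V l).HasOrthogonalProjection]
        (H HW HR : E →ₗ.[ℂ] E) (χ r : ℝ),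
        QuantumNumberTail.IsFrameworkHamiltonian V H HW HR χ r →
      ∀ (Ψ : E) (e δ lbar : ℝ),
        -- the unit vector `Ψ` is an eigenstate, with an eigenvalue `e` of multiplicity one
        ‖Ψ‖ = 1 →
        Ψ ∈ QuantumNumberTail.eigenspace H (e : ℂ) →
        Module.finrank ℂ (QuantumNumberTail.eigenspace H (e : ℂ)) = 1 →
        -- `e` is separated from the rest of the spectrum by a gap `δ`
        0 < δ →
        (∀ z ∈ QuantumNumberTail.spectrum H, z ≠ (e : ℂ) → δ ≤ ‖z - (e : ℂ)‖) →
        -- the mean absolute quantum number is finite and equal to `lbar`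
        HasSum (fun l : ℤ => |(l : ℝ)| * (⟪Ψ, (V l).starProjection Ψ⟫_ℂ).re) lbar →
      ∀ ε : ℝ, 0 < ε →
        ∃ Λ : ℝ, 0 ≤ Λ ∧
          |Λ ^ (1 - r) - (2 * lbar) ^ (1 - r)| ≤
            C * (χ * δ⁻¹ * Real.log ε⁻¹ ^ 2 + |Real.log ε⁻¹|) ∧
          ‖Ψ - QuantumNumberTail.window V Λ Ψ‖ ≤ ε := by
  open QuantumNumberTail in
  refine ⟨2000, by norm_num, ?_⟩
  intro E _ _ _ V _ H HW HR χ r h Ψ e δ lbar hΨ1 hΨ hdim hδ hgap hsum ε hε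
  simp only [re_inner_starProjection] at hsum
  have hl0 : 0 ≤ lbar := hsum.nonneg fun l => by positivity
  have hmass := norm_sub_window_sq_le h.hilbertSum hsum
  have hχ := h.chi_pos
  -- For large `ε`, Markov's inequality already suffices with `Λ = 2 * lbar`. Otherwise `log (1 /
  -- ε)` is bounded below by `1 / 3`, so constants can be absorbed into it and it into its square.
  rcases le_or_gt (1 / 2) (ε ^ 2) with hcase | hcase
  · refine ⟨2 * lbar, by positivity, ?_, le_of_sq_le_sq (hmass.trans hcase) hε.le⟩
    rw [sub_self, abs_zero]
    positivity
  set L := Real.log ε⁻¹ with hL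
  have hlog2 : Real.log 2 ≤ 2 * L := by
    have h1 : (2 : ℝ) ≤ ε⁻¹ ^ 2 := by
      rw [inv_pow, le_inv_comm₀ (by norm_num) (by positivity)]
      linarith
    have h2 := Real.log_le_log (by norm_num) h1
    rwa [Real.log_pow, Nat.cast_ofNat] at h2
  have hL3 : 1 ≤ 3 * L := by linarith [Real.log_two_gt_d9]
  have hL0 : 0 < L := by linarith
  -- The largest rate allowed by `a ≤ 1` and by the requirement `2 a χ ≤ δ / 32` of the gap
  -- argument.
  set a := min 1 (δ / (64 * χ)) with ha
  have ha0 : 0 < a := lt_min one_pos (by positivity)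
  have ha2 : 2 * a * χ ≤ δ / 32 := by
    have h1 : a ≤ δ / (64 * χ) := min_le_right _ _
    rw [le_div_iff₀ (by positivity)] at h1
    linarith
  have hlog8 : Real.log (8 * ε⁻¹) = 3 * Real.log 2 + L := by
    rw [Real.log_mul (by norm_num) (by positivity), show (8 : ℝ) = 2 ^ 3 by norm_num,
      Real.log_pow, Nat.cast_ofNat]
  have hlogpos : 0 < Real.log (8 * ε⁻¹) := by
    rw [hlog8]; have := Real.log_two_gt_d9; linarith
  set T := Real.log (8 * ε⁻¹) / a with hT
  have hT0 : 0 ≤ T := by positivity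
  have haT : a * T = Real.log (8 * ε⁻¹) := mul_div_cancel₀ _ ha0.ne'
  have hainv : a⁻¹ ≤ 1 + 64 * (χ * δ⁻¹) := by
    rcases min_choice 1 (δ / (64 * χ)) with h1 | h1 <;> rw [ha, h1]
    · rw [inv_one]; linarith [show 0 < χ * δ⁻¹ by positivity]
    · rw [inv_div, div_eq_mul_inv]; linarith
  -- `3 log 2 + L ≤ 7 L`, and `1344 = 7 * 64 * 3`, the `3` coming from `L ≤ 3 L²`.
  have hTle : T ≤ 7 * L + 1344 * (χ * δ⁻¹ * L ^ 2) := by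
    have h1 : T ≤ (7 * L) * (1 + 64 * (χ * δ⁻¹)) := by
      rw [hT, div_eq_mul_inv]
      exact mul_le_mul (by rw [hlog8]; linarith) hainv (by positivity) (by positivity)
    have h2 : χ * δ⁻¹ * L * 1 ≤ χ * δ⁻¹ * L * (3 * L) :=
      mul_le_mul_of_nonneg_left hL3 (by positivity)
    linarith
  have hs0 : 0 < 1 - r := by linarith [h.r_lt_one]
  have hs1 : 1 - r ≤ 1 := by linarith [h.r_nonneg]
  -- Replacing `2 * lbar + 2` by `2 * lbar` costs at most `2 ≤ 6 L` here, so the total error is at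
  -- most `13 L + 1344 χ δ⁻¹ L²`, within the constant `2000`.
  set A := (2 * lbar + 2) ^ (1 - r) + T with hA
  have hA0 : 0 ≤ A := by positivity
  have hΛ : (A ^ (1 - r)⁻¹) ^ (1 - r) = A := Real.rpow_inv_rpow hA0 hs0.ne'
  refine ⟨A ^ (1 - r)⁻¹, by positivity, ?_, ?_⟩
  · rw [hΛ]
    have h1 : (2 * lbar) ^ (1 - r) ≤ (2 * lbar + 2) ^ (1 - r) :=
      Real.rpow_le_rpow (by positivity) (by linarith) hs0.le
    have h2 := add_two_rpow_le (by positivity : 0 ≤ 2 * lbar) hs0.le hs1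
    have h3 : 0 ≤ χ * δ⁻¹ * L ^ 2 := by positivity
    rw [abs_of_nonneg (by linarith), abs_of_pos hL0]
    linarith
  · have h1 := exp_mul_norm_sub_window_le h hΨ1 hΨ hdim hδ hgap hmass ha0 (min_le_left _ _) ha2 hT0
      (Real.rpow_nonneg hA0 (1 - r)⁻¹) hΛ.ge
    rw [haT, Real.exp_log (by positivity), mul_assoc] at h1
    have h2 : ε⁻¹ * ‖Ψ - window V (A ^ (1 - r)⁻¹) Ψ‖ ≤ 1 := by linarith
    rwa [inv_mul_le_iff₀ hε, mul_one] at h2
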